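/- Let $n,d\ge 1$ and let $V\subset\mathbb P^n(\mathbb C)$ be a projective subvariety (a Zariski closed subset, irreducible or not) of dimension $k$ with $1\le k\le n$. Let $I(V)\subset\mathbb C[x_0,\dots,x_n]$ be its homogeneous ideal, $H_d$ the space of homogeneous polynomials of degree $d$ in $x_0,\dots,x_n$ (including $0$), and $I_d(V)=H_d/(I(V)\cap H_d)$. Let $Q_1,\dots,Q_q$, $q\ge k+1$, be hypersurfaces of common degree $d$ in $\mathbb P^n(\mathbb C)$, given by homogeneous polynomials $Q_i\in H_d$, none of them containing $V$. For $R\subset\{1,\dots,q\}$ let $\operatorname{rank}\{Q_i\}_{i\in R}$ be the dimension of the linear span of the classes $[Q_i]$, $i\in R$, in $I_d(V)$. Assume that the family is in $N$-subgeneral position with respect to $V$, that is, $V\cap\bigcap_{i\in R}Q_i=\varnothing$ for every $R\subset\{1,\dots,q\}$ with $|R|=N+1$, and that $q>2N-k+1$. Then there are rational numbers $\omega_1,\dots,\omega_q$ such that, with $\tilde\omega=\max_{1\le j\le q}\omega_j$: (i) $0<\omega_i\le 1$ for every $i$; (ii) $\sum_{j=1}^q\omega_j=\tilde\omega\,(q-2N+k-1)+k+1$;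 (iii) $\dfrac{k+1}{2N-k+1}\le\tilde\omega\le\dfrac kN$; (iv) $\sum_{i\in R}\omega_i\le k+1$ for every $R\subset\{1,\dots,q\}$ with $|R|=N+1$; (v) for all real numbers $E_1,\dots,E_q\ge 1$ and every $R\subset\{1,\dots,q\}$ with $|R|=N+1$ there is a subset $R^\circ\subset R$ (which may depend on the $E_i$) with $|R^\circ|=\operatorname{rank}\{Q_i\}_{i\in R^\circ}=k+1$ and $$\prod_{i\in R}E_i^{\omega_i}\le\prod_{i\in R^\circ}E_i .$$ -/

import Mathlib

open scoped LinearAlgebra.Projectivization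

namespace NochkaWeights

noncomputable section

/-- The set of points of complex projective `n`-space; it carries the Zariski topology below. -/
def ProjSpace (n : ℕ) : Type := ℙ ℂ (Fin (n + 1) → ℂ)

/-- The polynomial `f` vanishes at `p`, i.e. at every vector of homogeneous coordinates of `p`.
For homogeneous `f` one such vector suffices. -/
def VanishesAt {n : ℕ} (f : MvPolynomial (Fin (n + 1)) ℂ) (p : ProjSpace n) : Prop :=
  ∀ (v : Fin (n + 1) → ℂ) (hv : v ≠ 0), Projectivization.mk ℂ v hv = p →
    MvPolynomial.eval v f = 0

/-- The zero set in projective space of a polynomial (used for homogeneous polynomials). -/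
def hypersurface {n : ℕ} (f : MvPolynomial (Fin (n + 1)) ℂ) : Set (ProjSpace n) :=
  {p | VanishesAt f p}

/-- The Zariski topology: the complements of the zero sets of homogeneous polynomials
are a basis of open sets, so the closed sets are the projective algebraic sets. -/
instance zariskiTopology (n : ℕ) : TopologicalSpace (ProjSpace n) :=
  TopologicalSpace.generateFrom
    {U | ∃ (d : ℕ) (f : MvPolynomial (Fin (n + 1)) ℂ),
      f.IsHomogeneous d ∧ U = (hypersurface f)ᶜ}

/-- The homogeneous ideal `I(V)` of a subset `V` of projective space. -/
def vanishingIdeal {n : ℕ} (V : Set (ProjSpace n)) : Ideal (MvPolynomial (Fin (n + 1)) ℂ) where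
  carrier := {f | ∀ p ∈ V, VanishesAt f p}
  zero_mem' := fun p _ v hv _ => map_zero _
  add_mem' := fun {f g} hf hg p hp v hv hvp => by
    rw [map_add, hf p hp v hv hvp, hg p hp v hv hvp, add_zero]
  smul_mem' := fun c f hf p hp v hv hvp => by
    rw [smul_eq_mul, map_mul, hf p hp v hv hvp, mul_zero]

/-- The space `H_d` of homogeneous polynomials of degree `d` in `n + 1` variables
(together with `0`). -/
abbrev Forms (n d : ℕ) : Type := MvPolynomial.homogeneousSubmodule (Fin (n + 1)) ℂ d

/-- `I(V) ∩ H_d`, as a subspace of `H_d`. -/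
def vanishingForms {n : ℕ} (V : Set (ProjSpace n)) (d : ℕ) : Submodule ℂ (Forms n d) :=
  ((vanishingIdeal V).restrictScalars ℂ).comap
    (MvPolynomial.homogeneousSubmodule (Fin (n + 1)) ℂ d).subtype

/-- `I_d(V) = H_d / (I(V) ∩ H_d)`. -/
abbrev FormsOn {n : ℕ} (V : Set (ProjSpace n)) (d : ℕ) : Type :=
  Forms n d ⧸ vanishingForms V d

/-- The rank of `{Q_i}_{i ∈ R}`: the dimension of the span of the classes `[Q_i]`, `i ∈ R`,
in `I_d(V)`. -/
def rankOn {n d q : ℕ} (V : Set (ProjSpace n)) (Q : Fin q → Forms n d) (R : Finset (Fin q)) : ℕ :=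
  Module.finrank ℂ
    (Submodule.span ℂ ((fun i => (Submodule.Quotient.mk (Q i) : FormsOn V d)) '' (R : Set (Fin q))))

/-- `N`-subgeneral position with respect to `V`: any `N + 1` of the hypersurfaces (with distinct
indices) have no common point on `V`. -/
def InSubgeneralPosition {n d q : ℕ} (N : ℕ) (V : Set (ProjSpace n)) (Q : Fin q → Forms n d) :
    Prop :=
  ∀ R : Finset (Fin q), R.card = N + 1 →
    V ∩ ⋂ i ∈ R, hypersurface (Q i : MvPolynomial (Fin (n + 1)) ℂ) = ∅

end

end NochkaWeights

/-!
The weights depend only on the rank function `ρ` of the hypersurfaces, truncated at `k + 1`. Plot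
each set `R` of indices as the point `(#R, ρ R)` of the plane, put `P = (2N - k + 1, k + 1)` and
take the steepest line through `P` and a point `S` of rank at most `k`. Its slope `t` is the
largest weight, given to every index outside `S`; since no point of rank at most `k` lies below
the line, `S` carries positive weights bounded by `t`, of total `ρ S` and of total at most `ρ T`
on each `T ⊆ S`. Submodularity of `ρ` then gives `∑ i ∈ R, ω i ≤ ρ R` whenever `#R ≤ N + 1`, and
(v) is the greedy algorithm for matroids with the values `log (E i)`.

Geometry enters only through the fact that any `N + 1` of the hypersurfaces have rank greater than
`k`. Otherwise at most `k` of them span the others modulo `I(V)`, so these `k` have no common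
point on `V` either. Prolong the primes of a chain of `k + 1` irreducible closed subsets of `V` by
the irrelevant ideal. The chain now has length `k + 1`, but by the Nullstellensatz its last prime
is minimal over its first prime together with `k` forms, against Krull's height theorem.
-/

namespace NochkaWeights

section RankFunction

open Finset

/-- The axioms of the rank function of a matroid on `ι`, restricted to finite sets. Matroids are
handled through their rank functions here because truncation then is just a minimum. -/
structure IsRankFunction {ι : Type*} [DecidableEq ι] (ρ : Finset ι → ℕ) : Prop where
  empty : ρ ∅ = 0
  mono : Monotone ρ
  insert_le (i : ι) (S : Finset ι) : ρ (insert i S) ≤ ρ S + 1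
  submodular (S T : Finset ι) : ρ (S ∪ T) + ρ (S ∩ T) ≤ ρ S + ρ T

/-- `B` is a basis of `R` with respect to the rank function `ρ`: an independent subset of `R` of
full rank. -/
structure IsRankBasis {ι : Type*} (ρ : Finset ι → ℕ) (B R : Finset ι) : Prop where
  subset : B ⊆ R
  rank_self : ρ B = #B
  rank_eq : ρ B = ρ R

/-- The extended polymatroid of `f` on `S`: the weights whose total over each `T ⊆ S` is at most
`f T`. Its nonnegative part is the independence polytope of a matroid when `f` is a rank function.
The coordinates outside `S` are unconstrained. -/
def extendedPolymatroid {ι : Type*} (K : Type*) [Semiring K] [PartialOrder K]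
    (f : Finset ι → ℕ) (S : Finset ι) : Set (ι → K) :=
  {x | ∀ T ⊆ S, ∑ i ∈ T, x i ≤ f T}

variable {ι K : Type*} [Field K] [LinearOrder K] [IsStrictOrderedRing K]

theorem exists_add_single_mem_extendedPolymatroid [DecidableEq ι] {f : Finset ι → ℕ}
    {S : Finset ι} {x : ι → K} (hx : x ∈ extendedPolymatroid K f S) {i : ι} (hi : i ∈ S) {t : K}
    (hxt : x i ≤ t) :
    ∃ δ, 0 ≤ δ ∧ x i + δ ≤ t ∧ x + Pi.single i δ ∈ extendedPolymatroid K f S ∧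
      (x i + δ = t ∨ ∃ T ⊆ S, i ∈ T ∧ ∑ j ∈ T, (x + Pi.single i δ : ι → K) j = f T) := by
  obtain ⟨T₀, hT₀, hmin⟩ := ({T ∈ S.powerset | i ∈ T}).exists_min_image
    (fun T => (f T : K) - ∑ j ∈ T, x j) ⟨S, by simp [hi]⟩
  simp only [mem_filter, mem_powerset, and_imp] at hT₀ hmin
  obtain ⟨hT₀S, hiT₀⟩ := hT₀
  have hslack : 0 ≤ (f T₀ : K) - ∑ j ∈ T₀, x j := sub_nonneg.2 (hx T₀ hT₀S)
  have hsum (δ : K) (T : Finset ι) :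
      ∑ j ∈ T, (x + Pi.single i δ : ι → K) j = ∑ j ∈ T, x j + if i ∈ T then δ else 0 := by
    simp only [Pi.add_apply, sum_add_distrib, sum_pi_single']
  refine ⟨min (t - x i) (f T₀ - ∑ j ∈ T₀, x j), le_min (sub_nonneg.2 hxt) hslack,
    by linarith [min_le_left (t - x i) (f T₀ - ∑ j ∈ T₀, x j)], fun T hT => ?_, ?_⟩
  · rw [hsum]
    split_ifs with hiT
    · linarith [hmin T hT hiT, min_le_right (t - x i) (f T₀ - ∑ j ∈ T₀, x j)]
    · linarith [hx T hT]
  · rcases min_choice (t - x i) (f T₀ - ∑ j ∈ T₀, x j) with h | h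
    · exact Or.inl (by rw [h, add_sub_cancel])
    · exact Or.inr ⟨T₀, hT₀S, hiT₀, by rw [hsum, if_pos hiT₀, h, add_sub_cancel]⟩

theorem exists_saturated_ge_of_mem_extendedPolymatroid {f : Finset ι → ℕ} {S : Finset ι}
    {x : ι → K} (hx : x ∈ extendedPolymatroid K f S) {t : K} (hxt : ∀ i, x i ≤ t) :
    ∃ y ∈ extendedPolymatroid K f S, x ≤ y ∧ (∀ i, y i ≤ t) ∧
      ∀ i ∈ S, y i = t ∨ ∃ T ⊆ S, i ∈ T ∧ ∑ j ∈ T, y j = f T := by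
  classical
  suffices ∀ U ⊆ S, ∃ y ∈ extendedPolymatroid K f S, x ≤ y ∧ (∀ i, y i ≤ t) ∧
      ∀ i ∈ U, y i = t ∨ ∃ T ⊆ S, i ∈ T ∧ ∑ j ∈ T, y j = f T from this S Subset.rfl
  intro U
  induction U using Finset.induction_on with
  | empty => exact fun _ => ⟨x, hx, le_rfl, hxt, by simp⟩
  | insert i U _ ih =>
    intro hU
    obtain ⟨hiS, hUS⟩ := insert_subset_iff.1 hU
    obtain ⟨y, hy, hxy, hyt, hsat⟩ := ih hUS
    obtain ⟨δ, hδ, hδt, hz, hzi⟩ := exists_add_single_mem_extendedPolymatroid hy hiS (hyt i)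
    set z := y + Pi.single i δ with hz_def
    have hzi_eq : z i = y i + δ := by simp [hz_def]
    have hyz : y ≤ z := le_add_of_nonneg_right (Pi.single_nonneg.2 hδ)
    have hzt (j : ι) : z j ≤ t := by
      rcases eq_or_ne j i with rfl | hji
      · rwa [hzi_eq]
      · simpa [hz_def, hji] using hyt j
    refine ⟨z, hz, hxy.trans hyz, hzt, fun j hj => ?_⟩
    rcases mem_insert.1 hj with rfl | hjU
    · rwa [hzi_eq]
    · rcases hsat j hjU with h | ⟨T, hT, hjT, h⟩
      · exact Or.inl (le_antisymm (hzt j) (h ▸ hyz j))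
      · exact Or.inr ⟨T, hT, hjT, le_antisymm (hz T hT) (h ▸ sum_le_sum fun j _ => hyz j)⟩

variable {ρ : Finset ι → ℕ}

namespace IsRankFunction

variable [DecidableEq ι]

theorem le_card (hρ : IsRankFunction ρ) (S : Finset ι) : ρ S ≤ #S := by
  induction S using Finset.induction_on with
  | empty => exact hρ.empty.le
  | insert i S hi ih =>
    rw [card_insert_of_notMem hi]
    exact (hρ.insert_le i S).trans (Nat.add_le_add_right ih 1)

theorem truncate (hρ : IsRankFunction ρ) (m : ℕ) : IsRankFunction fun S => min (ρ S) m where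
  empty := by simp [hρ.empty]
  mono _ _ h := min_le_min_right m (hρ.mono h)
  insert_le i S := by have := hρ.insert_le i S; omega
  submodular S T := by
    have := hρ.submodular S T
    have := hρ.mono (subset_union_left : S ⊆ S ∪ T)
    have := hρ.mono (subset_union_right : T ⊆ S ∪ T)
    have := hρ.mono (inter_subset_left : S ∩ T ⊆ S)
    have := hρ.mono (inter_subset_right : S ∩ T ⊆ T)
    omega

theorem exists_lt_insert_of_lt (hρ : IsRankFunction ρ) {S T : Finset ι} (h : ρ S < ρ T) :
    ∃ i ∈ T, ρ S < ρ (insert i S) := by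
  by_contra! hins
  suffices ∀ U ⊆ T, ρ (S ∪ U) ≤ ρ S from
    h.not_ge ((hρ.mono subset_union_right).trans (this T Subset.rfl))
  intro U
  induction U using Finset.induction_on with
  | empty => simp
  | insert i U _ ih =>
    intro hU
    obtain ⟨hiT, hUT⟩ := insert_subset_iff.1 hU
    have hsub := hρ.submodular (S ∪ U) (insert i S)
    have hunion : S ∪ U ∪ insert i S = S ∪ insert i U := by grind
    have hinter : ρ S ≤ ρ ((S ∪ U) ∩ insert i S) :=
      hρ.mono (subset_inter subset_union_left (subset_insert _ _))
    rw [hunion] at hsub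
    have := hins i hiT
    have := ih hUT
    omega

theorem exists_isRankBasis_insert (hρ : IsRankFunction ρ) {B R : Finset ι}
    (hB : IsRankBasis ρ B R) (j : ι) :
    ∃ B', IsRankBasis ρ B' (insert j R) ∧ B ⊆ B' ∧ B' ⊆ insert j B := by
  rcases (hρ.mono (subset_insert j R)).eq_or_lt with heq | hlt
  · exact ⟨B, ⟨hB.subset.trans (subset_insert _ _), hB.rank_self, hB.rank_eq.trans heq⟩,
      Subset.rfl, subset_insert _ _⟩
  · have hsub := hρ.submodular (insert j B) R
    have hinter : ρ B ≤ ρ (insert j B ∩ R) :=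
      hρ.mono (subset_inter (subset_insert _ _) hB.subset)
    rw [insert_union, union_eq_right.2 hB.subset] at hsub
    have hjB : j ∉ B := fun h => hlt.ne (by rw [insert_eq_of_mem (hB.subset h)])
    have := hρ.insert_le j B
    have := hρ.mono (insert_subset_insert j hB.subset)
    have := hB.rank_self
    have := hB.rank_eq
    exact ⟨insert j B, ⟨insert_subset_insert j hB.subset,
      by rw [card_insert_of_notMem hjB]; omega, by omega⟩, subset_insert _ _, Subset.rfl⟩

theorem exists_isRankBasis (hρ : IsRankFunction ρ) (R : Finset ι) : ∃ B, IsRankBasis ρ B R := by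
  induction R using Finset.induction_on with
  | empty => exact ⟨∅, Subset.rfl, by simp [hρ.empty], rfl⟩
  | insert j R _ ih =>
    obtain ⟨B, hB⟩ := ih
    obtain ⟨B', hB', -⟩ := hρ.exists_isRankBasis_insert hB j
    exact ⟨B', hB'⟩

/- The greedy algorithm adds elements in decreasing order of their values `a`. For the induction the
values are counted from an arbitrary lower bound `c`, which is replaced by `a j` whenever a new
smallest element `j` comes in. -/
theorem exists_isRankBasis_sum_mul_sub_le (hρ : IsRankFunction ρ) (w a : ι → K) (R : Finset ι)
    (hw : w ∈ extendedPolymatroid K ρ R) :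
    ∃ B, IsRankBasis ρ B R ∧
      ∀ c, (∀ i ∈ R, c ≤ a i) → ∑ i ∈ R, w i * (a i - c) ≤ ∑ i ∈ B, (a i - c) := by
  induction R using Finset.induction_on_min_value a with
  | empty => exact ⟨∅, ⟨Subset.rfl, by simp [hρ.empty], rfl⟩, by simp⟩
  | insert j R hjR hmin ih =>
    obtain ⟨B, hB, hle⟩ := ih fun T hT => hw T (hT.trans (subset_insert _ _))
    obtain ⟨B', hB', hBB', hB'j⟩ := hρ.exists_isRankBasis_insert hB j
    refine ⟨B', hB', fun c hc => ?_⟩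
    have hvalue : ∑ i ∈ B', (a i - a j) = ∑ i ∈ B, (a i - a j) :=
      (sum_subset hBB' fun i hi hiB => by
        rw [(mem_insert.1 (hB'j hi)).resolve_right hiB, sub_self]).symm
    have hcard : ∑ i ∈ insert j R, w i ≤ #B' := by
      rw [← hB'.rank_self, hB'.rank_eq]
      exact hw _ Subset.rfl
    calc ∑ i ∈ insert j R, w i * (a i - c)
        = ∑ i ∈ R, w i * (a i - a j) + (a j - c) * ∑ i ∈ insert j R, w i := by
          simp only [sum_insert hjR, mul_sub, sum_sub_distrib, ← sum_mul]; ring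
      _ ≤ ∑ i ∈ B, (a i - a j) + (a j - c) * #B' := by
          gcongr
          · exact hle _ hmin
          · exact sub_nonneg.2 (hc j (mem_insert_self _ _))
      _ = ∑ i ∈ B', (a i - c) := by
          rw [← hvalue]
          simp only [sum_sub_distrib, sum_const, nsmul_eq_mul]; ring

theorem exists_isRankBasis_prod_rpow_le_prod (hρ : IsRankFunction ρ) {w : ι → ℝ} {R : Finset ι}
    (hw : w ∈ extendedPolymatroid ℝ ρ R) {E : ι → ℝ} (hE : ∀ i, 1 ≤ E i) :
    ∃ B, IsRankBasis ρ B R ∧ ∏ i ∈ R, E i ^ w i ≤ ∏ i ∈ B, E i := by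
  obtain ⟨B, hB, hle⟩ := hρ.exists_isRankBasis_sum_mul_sub_le w (fun i => Real.log (E i)) R hw
  have hE0 (i : ι) : 0 < E i := zero_lt_one.trans_le (hE i)
  refine ⟨B, hB, ?_⟩
  calc ∏ i ∈ R, E i ^ w i = Real.exp (∑ i ∈ R, w i * Real.log (E i)) := by
        simp only [Real.exp_sum, Real.rpow_def_of_pos (hE0 _), mul_comm]
    _ ≤ Real.exp (∑ i ∈ B, Real.log (E i)) := by
        simpa using hle 0 fun i _ => Real.log_nonneg (hE i)
    _ = ∏ i ∈ B, E i := by simp only [Real.exp_sum, Real.exp_log (hE0 _)]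

theorem const_mem_extendedPolymatroid (hρ : IsRankFunction ρ) (hloop : ∀ i, 0 < ρ {i})
    {S : Finset ι} {c : K} (hc : 0 ≤ c) (hcS : #S * c ≤ 1) :
    (fun _ => c) ∈ extendedPolymatroid K ρ S := by
  intro T hT
  rw [sum_const, nsmul_eq_mul]
  rcases T.eq_empty_or_nonempty with rfl | ⟨i, hi⟩
  · simp
  have hρT : 1 ≤ ρ T := (hloop i).trans_le (hρ.mono (singleton_subset_iff.2 hi))
  calc (#T : K) * c ≤ #S * c := by gcongr
    _ ≤ 1 := hcS
    _ ≤ ρ T := mod_cast hρT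

theorem sum_union_eq_of_sum_eq (hρ : IsRankFunction ρ) {S T T' : Finset ι} {y : ι → K}
    (hy : y ∈ extendedPolymatroid K ρ S) (hTS : T ⊆ S) (hTS' : T' ⊆ S)
    (hT : ∑ i ∈ T, y i = ρ T) (hT' : ∑ i ∈ T', y i = ρ T') :
    ∑ i ∈ T ∪ T', y i = ρ (T ∪ T') := by
  have hsub : (ρ (T ∪ T') : K) + ρ (T ∩ T') ≤ ρ T + ρ T' := mod_cast hρ.submodular T T'
  linarith [sum_union_inter (s₁ := T) (s₂ := T') (f := y), hy _ (union_subset hTS hTS'),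
    hy _ (inter_subset_left.trans hTS : T ∩ T' ⊆ S)]

/- Saturating a small constant weight and uniting all tight sets gives a tight set outside of which
the weight is `t`; the hypothesis on `S` forces `S` itself to be tight. -/
theorem exists_pos_mem_extendedPolymatroid_sum_eq (hρ : IsRankFunction ρ)
    (hloop : ∀ i, 0 < ρ {i}) {S : Finset ι} {t : K} (ht : 0 < t)
    (hS : ∀ T ⊆ S, (ρ S : K) - t * #S ≤ ρ T - t * #T) :
    ∃ y ∈ extendedPolymatroid K ρ S, (∀ i, 0 < y i) ∧ (∀ i, y i ≤ t) ∧
      ∑ i ∈ S, y i = ρ S := by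
  have hc : 0 < min t (1 / (#S + 1 : K)) := lt_min ht (by positivity)
  have hcS : #S * min t (1 / (#S + 1 : K)) ≤ 1 :=
    calc #S * min t (1 / (#S + 1 : K)) ≤ #S * (1 / (#S + 1 : K)) := by
          gcongr; exact min_le_right _ _
      _ ≤ 1 := by rw [mul_one_div, div_le_one (by positivity)]; linarith
  obtain ⟨y, hy, hcy, hyt, hsat⟩ := exists_saturated_ge_of_mem_extendedPolymatroid
    (hρ.const_mem_extendedPolymatroid hloop hc.le hcS) fun _ => min_le_left _ _
  refine ⟨y, hy, fun i => hc.trans_le (hcy i), hyt, (hy S Subset.rfl).antisymm ?_⟩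
  let tightSets := {T ∈ S.powerset | ∑ i ∈ T, y i = ρ T}
  obtain ⟨hTS, hT⟩ : tightSets.sup id ⊆ S ∧
      ∑ i ∈ tightSets.sup id, y i = ρ (tightSets.sup id) := by
    refine sup_induction (p := fun T => T ⊆ S ∧ ∑ i ∈ T, y i = ρ T)
      ⟨empty_subset S, by simp [hρ.empty]⟩ (fun A hA B hB => ⟨union_subset hA.1 hB.1, ?_⟩) ?_
    · exact hρ.sum_union_eq_of_sum_eq hy hA.1 hB.1 hA.2 hB.2
    · simp [tightSets]
  set T := tightSets.sup id
  have hout : ∀ i ∈ S \ T, y i = t := fun i hi => by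
    obtain ⟨hiS, hiT⟩ := mem_sdiff.1 hi
    refine (hsat i hiS).resolve_right fun ⟨T', hT'S, hiT', hT'⟩ => hiT ?_
    exact le_sup (f := id) (by simpa [tightSets] using ⟨hT'S, hT'⟩ : T' ∈ tightSets) hiT'
  calc (ρ S : K) ≤ t * (#S - #T) + ρ T := by linarith [hS T hTS]
    _ = ∑ i ∈ S, y i := by
      rw [← sum_sdiff hTS, hT, sum_congr rfl hout, sum_const, nsmul_eq_mul,
        cast_card_sdiff hTS, mul_comm]

theorem card_add_le_of_rank_le [Fintype ι] (hρ : IsRankFunction ρ) {k N : ℕ}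
    (hcard : N + 1 ≤ Fintype.card ι) (hN : ∀ R, #R = N + 1 → k < ρ R) (R : Finset ι)
    (hR : ρ R ≤ k) : #R + k ≤ N + ρ R := by
  induction hm : k - ρ R generalizing R with
  | zero =>
    by_contra! hlt
    obtain ⟨R', hR', hR'card⟩ := exists_subset_card_eq (by omega : N + 1 ≤ #R)
    exact absurd (hN R' hR'card) ((hρ.mono hR').trans hR).not_gt
  | succ m ih =>
    obtain ⟨R', -, hR'card⟩ := exists_subset_card_eq (s := (univ : Finset ι)) hcard
    obtain ⟨i, -, hi⟩ := hρ.exists_lt_insert_of_lt (hR.trans_lt (hN R' hR'card))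
    have hiR : i ∉ R := fun h => hi.ne (by rw [insert_eq_of_mem h])
    have hins := hρ.insert_le i R
    have := ih (insert i R) (by omega) (by omega)
    rw [card_insert_of_notMem hiR] at this
    omega

end IsRankFunction

/-- Nochka's picture: represent each set `R` by the point `(#R, ρ R)` of the plane and let
`P = (2N - k + 1, k + 1)`. The line of slope `t` through `P` passes through the point of `S`, and no
set of rank at most `k` has its point below this line. -/
structure IsSupportingSlope (ρ : Finset ι → ℕ) (k N : ℕ) (S : Finset ι) (t : K) : Prop where
  rank_le : ρ S ≤ k
  line_eq : t * (2 * N - k + 1 - #S) = k + 1 - ρ S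
  line_le (R : Finset ι) (hR : ρ R ≤ k) : k + 1 - ρ R ≤ t * (2 * N - k + 1 - #R)

namespace IsSupportingSlope

variable {k N : ℕ} {S : Finset ι} {t : K}

theorem exists_of_card_add_le [Finite ι] (hempty : ρ ∅ = 0)
    (hflat : ∀ R, ρ R ≤ k → #R + k ≤ N + ρ R) :
    ∃ (S : Finset ι) (t : K), IsSupportingSlope ρ k N S t := by
  cases nonempty_fintype ι
  have hden (R : Finset ι) (hR : ρ R ≤ k) : (0 : K) < 2 * N - k + 1 - #R := by
    have hlt : #R + k < 2 * N + 1 := by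
      have := hflat R hR
      have := hflat ∅ (by omega)
      rw [hempty, card_empty] at this
      omega
    have : (#R + k : K) < 2 * N + 1 := mod_cast hlt
    linarith
  obtain ⟨S, hS, hmax⟩ := ({S : Finset ι | ρ S ≤ k} : Finset (Finset ι)).exists_max_image
    (fun S => ((k : K) + 1 - ρ S) / (2 * N - k + 1 - #S)) ⟨∅, by simp [hempty]⟩
  simp only [mem_filter, mem_univ, true_and] at hS hmax
  exact ⟨S, _, hS, div_mul_cancel₀ _ (hden S hS).ne',
    fun R hR => (div_le_iff₀ (hden R hR)).1 (hmax R hR)⟩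

theorem pos (h : IsSupportingSlope ρ k N S t) (hkN : k ≤ N)
    (hflat : ∀ R, ρ R ≤ k → #R + k ≤ N + ρ R) : 0 < t := by
  have hS : (ρ S : K) ≤ k := mod_cast h.rank_le
  have hSN : (#S + k : K) ≤ N + ρ S := mod_cast hflat S h.rank_le
  have hkN' : (k : K) ≤ N := mod_cast hkN
  exact pos_of_mul_pos_left (by linarith [h.line_eq] : 0 < t * (2 * N - k + 1 - #S)) (by linarith)

theorem mul_le (h : IsSupportingSlope ρ k N S t) (hkN : k ≤ N)
    (hflat : ∀ R, ρ R ≤ k → #R + k ≤ N + ρ R) : t * (N + 1 - ρ S) ≤ k + 1 - ρ S := by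
  have hSN : (#S + k : K) ≤ N + ρ S := mod_cast hflat S h.rank_le
  rw [← h.line_eq]
  exact mul_le_mul_of_nonneg_left (by linarith) (h.pos hkN hflat).le

theorem le_one (h : IsSupportingSlope ρ k N S t) (hkN : k ≤ N)
    (hflat : ∀ R, ρ R ≤ k → #R + k ≤ N + ρ R) : t ≤ 1 := by
  have hS : (ρ S : K) ≤ k := mod_cast h.rank_le
  have hkN' : (k : K) ≤ N := mod_cast hkN
  exact le_of_mul_le_mul_right (by linarith [h.mul_le hkN hflat])
    (by linarith : (0 : K) < N + 1 - ρ S)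

theorem div_le (h : IsSupportingSlope ρ k N S t) (hempty : ρ ∅ = 0) (hkN : k ≤ N) :
    ((k : K) + 1) / (2 * N - k + 1) ≤ t := by
  have hkN' : (k : K) ≤ N := mod_cast hkN
  rw [div_le_iff₀ (by linarith [N.cast_nonneg (α := K)])]
  simpa [hempty] using h.line_le ∅ (by simp [hempty])

theorem le_div [DecidableEq ι] (h : IsSupportingSlope ρ k N S t) (hρ : IsRankFunction ρ)
    (hloop : ∀ i, 0 < ρ {i}) (hk : 1 ≤ k) (hkN : k ≤ N)
    (hflat : ∀ R, ρ R ≤ k → #R + k ≤ N + ρ R) : t ≤ (k : K) / N := by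
  have hk' : (1 : K) ≤ k := mod_cast hk
  have hkN' : (k : K) ≤ N := mod_cast hkN
  rw [le_div_iff₀ (by linarith)]
  rcases S.eq_empty_or_nonempty with rfl | ⟨i, hi⟩
  · have hline := h.line_eq
    simp only [hρ.empty, card_empty, Nat.cast_zero, sub_zero] at hline
    refine le_of_mul_le_mul_right ?_ (by linarith : (0 : K) < 2 * N - k + 1)
    calc t * N * (2 * N - k + 1) = N * (k + 1) := by rw [← hline]; ring
      _ ≤ k * (2 * N - k + 1) := by
        linarith [mul_nonneg (sub_nonneg.2 hkN') (sub_nonneg.2 hk')]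
  · have hS : (1 : K) ≤ ρ S :=
      mod_cast (hloop i).trans_le (hρ.mono (singleton_subset_iff.2 hi))
    linarith [h.mul_le hkN hflat,
      mul_nonneg (sub_nonneg.2 hS) (sub_nonneg.2 (h.le_one hkN hflat))]

theorem mul_card_sdiff_add_rank_inter_le [DecidableEq ι] (h : IsSupportingSlope ρ k N S t)
    (hρ : IsRankFunction ρ) (hkN : k ≤ N) (hflat : ∀ R, ρ R ≤ k → #R + k ≤ N + ρ R)
    {R : Finset ι} (hR : #R ≤ N + 1) : t * #(R \ S) + ρ (R ∩ S) ≤ ρ R := by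
  have hsub : (ρ (R ∪ S) + ρ (R ∩ S) : K) ≤ ρ R + ρ S := mod_cast hρ.submodular R S
  rcases le_or_gt (ρ (R ∪ S)) k with hRS | hRS
  · have hcard : (#(R ∪ S) : K) = #(R \ S) + #S := mod_cast card_sdiff_add_card R S ▸ rfl
    have hline := h.line_le _ hRS
    rw [hcard] at hline
    linarith [h.line_eq]
  · have hcardR : (#R + k : K) ≤ N + ρ R := by
      have : #R + k ≤ N + ρ R := (le_or_gt (ρ R) k).elim (hflat R) (by omega)
      exact_mod_cast this
    have hcard : (#(R \ S) + #(R ∩ S) : K) = #R := mod_cast card_sdiff_add_card_inter R S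
    have hinter : (ρ (R ∩ S) : K) ≤ #(R ∩ S) := mod_cast hρ.le_card _
    have hRS' : (k + 1 : K) ≤ ρ (R ∪ S) := mod_cast hRS
    have ht := h.le_one hkN hflat
    have hdefect : 0 ≤ (1 - t) * (ρ R - ρ (R ∩ S) - (k + 1 - ρ S) : K) :=
      mul_nonneg (sub_nonneg.2 ht) (by linarith)
    have : t * #(R \ S) ≤ t * (N - k + (ρ R - ρ (R ∩ S))) :=
      mul_le_mul_of_nonneg_left (by linarith) (h.pos hkN hflat).le
    linarith [h.mul_le hkN hflat]

end IsSupportingSlope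

namespace IsRankFunction

variable [Fintype ι] [DecidableEq ι]

theorem exists_weights_mem_extendedPolymatroid (hρ : IsRankFunction ρ) (hloop : ∀ i, 0 < ρ {i})
    {k N : ℕ} (hk : 1 ≤ k) (hq : 2 * N + 1 < Fintype.card ι + k) (hkN : k ≤ N)
    (hN : ∀ R, #R = N + 1 → k < ρ R) :
    ∃ (ω : ι → K) (t : K), (∀ i, 0 < ω i) ∧ IsGreatest (Set.range ω) t ∧
      ∑ i, ω i = t * (Fintype.card ι - 2 * N + k - 1) + k + 1 ∧
      ((k : K) + 1) / (2 * N - k + 1) ≤ t ∧ t ≤ (k : K) / N ∧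
      ∀ R, #R ≤ N + 1 → ω ∈ extendedPolymatroid K ρ R := by
  have hflat := hρ.card_add_le_of_rank_le (by omega) hN
  obtain ⟨S, t, h⟩ := IsSupportingSlope.exists_of_card_add_le (K := K) hρ.empty hflat
  have ht := h.pos hkN hflat
  obtain ⟨y, hy, hypos, hyt, hyS⟩ := hρ.exists_pos_mem_extendedPolymatroid_sum_eq hloop ht
    fun T hT => by linarith [h.line_eq, h.line_le T ((hρ.mono hT).trans h.rank_le)]
  obtain ⟨i₀, hi₀⟩ : ∃ i, i ∉ S := by
    by_contra! hS
    have := hflat S h.rank_le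
    have := h.rank_le
    have : #S = Fintype.card ι := card_eq_iff_eq_univ S |>.2 (eq_univ_of_forall hS)
    omega
  let ω : ι → K := S.piecewise y fun _ => t
  have hsum (R : Finset ι) : ∑ i ∈ R, ω i = ∑ i ∈ R ∩ S, y i + t * #(R \ S) := by
    rw [sum_piecewise, sum_const, nsmul_eq_mul, mul_comm]
  refine ⟨ω, t, fun i => ?_, ⟨⟨i₀, S.piecewise_eq_of_notMem _ _ hi₀⟩, ?_⟩, ?_,
    h.div_le hρ.empty hkN, h.le_div hρ hloop hk hkN hflat, fun R hR T hT => ?_⟩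
  · exact S.piecewise_cases y _ (0 < ·) (hypos i) ht
  · rintro _ ⟨i, rfl⟩
    exact S.piecewise_cases y _ (· ≤ t) (hyt i) le_rfl
  · rw [hsum, univ_inter, hyS, cast_card_sdiff (subset_univ S), card_univ]
    linarith [h.line_eq]
  · rw [hsum]
    linarith [hy (T ∩ S) inter_subset_right,
      h.mul_card_sdiff_add_rank_inter_le hρ hkN hflat ((card_le_card hT).trans hR)]

theorem exists_nochka_weights (hρ : IsRankFunction ρ) (hloop : ∀ i, 0 < ρ {i}) {k N : ℕ}
    (hk : 1 ≤ k) (hcard : k + 1 ≤ Fintype.card ι) (hq : 2 * N + 1 < Fintype.card ι + k)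
    (hN : ∀ R, #R = N + 1 → k < ρ R) :
    ∃ (ω : ι → ℚ) (t : ℚ), (∀ i, 0 < ω i ∧ ω i ≤ 1) ∧ IsGreatest (Set.range ω) t ∧
      ∑ i, ω i = t * (Fintype.card ι - 2 * N + k - 1) + k + 1 ∧
      ((k : ℚ) + 1) / (2 * N - k + 1) ≤ t ∧ t ≤ (k : ℚ) / N ∧
      (∀ R, #R = N + 1 → ∑ i ∈ R, ω i ≤ k + 1) ∧
      ∀ E : ι → ℝ, (∀ i, 1 ≤ E i) → ∀ R, #R = N + 1 →
        ∃ B ⊆ R, #B = k + 1 ∧ ρ B = k + 1 ∧ ∏ i ∈ R, E i ^ (ω i : ℝ) ≤ ∏ i ∈ B, E i := by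
  have hkN : k ≤ N := by
    obtain ⟨R, -, hR⟩ := exists_subset_card_eq (s := (univ : Finset ι)) (n := N + 1) (by
      rw [card_univ]; omega)
    have := hN R hR
    have := hρ.le_card R
    omega
  have hrank (R : Finset ι) (hR : #R = N + 1) : min (ρ R) (k + 1) = k + 1 := min_eq_right (hN R hR)
  have hρ' := hρ.truncate (k + 1)
  obtain ⟨ω, t, hω, hmax, hsum, hlow, hupp, hmem⟩ :=
    hρ'.exists_weights_mem_extendedPolymatroid (K := ℚ) (fun i => lt_min (hloop i) k.succ_pos) hk hq
      hkN fun R hR => (hrank R hR).ge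
  have ht : t ≤ 1 := hupp.trans (div_le_one_of_le₀ (mod_cast hkN) N.cast_nonneg)
  refine ⟨ω, t, fun i => ⟨hω i, (hmax.2 ⟨i, rfl⟩).trans ht⟩, hmax, hsum, hlow, hupp,
    fun R hR => ?_, fun E hE R hR => ?_⟩
  · simpa only [hrank R hR, Nat.cast_succ] using hmem R hR.le R Subset.rfl
  · have hmem' : (fun i => (ω i : ℝ)) ∈ extendedPolymatroid ℝ (fun S => min (ρ S) (k + 1)) R :=
      fun T hT => by
        simpa only [← Rat.cast_sum] using mod_cast hmem R hR.le T hT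
    obtain ⟨B, hB, hle⟩ := hρ'.exists_isRankBasis_prod_rpow_le_prod hmem' hE
    have hBk : min (ρ B) (k + 1) = k + 1 := hB.rank_eq.trans (hrank R hR)
    have hcardB : #B = k + 1 := hB.rank_self.symm.trans hBk
    exact ⟨B, hB.subset, hcardB, ((hρ.le_card B).trans hcardB.le).antisymm (min_eq_right_iff.1 hBk),
      hle⟩

end IsRankFunction

end RankFunction

section RestrictLine

open MvPolynomial

variable {σ R : Type*} [CommSemiring R]

theorem aeval_smul_of_isHomogeneous {A : Type*} [CommSemiring A] [Algebra R A]
    {f : MvPolynomial σ R} {d : ℕ} (hf : f.IsHomogeneous d) (a : A) (v : σ → A) :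
    aeval (a • v) f = a ^ d * aeval v f := by
  rw [aeval_def, aeval_def, eval₂_eq, eval₂_eq, Finset.mul_sum]
  refine Finset.sum_congr rfl fun m hm => ?_
  have hdeg : m.degree = d := by
    rw [Finsupp.degree_eq_weight_one]
    exact hf (mem_support_iff.1 hm)
  simp only [Pi.smul_apply, smul_eq_mul, mul_pow, Finset.prod_mul_distrib,
    Finset.prod_pow_eq_pow_sum, ← hdeg, Finsupp.degree_apply]
  exact mul_left_comm _ _ _

/-- The restriction of a polynomial to the line through the origin spanned by `v`: the univariate
polynomial `f (X v)`. Its coefficients are the values at `v` of the homogeneous components. -/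
noncomputable def restrictLine (v : σ → R) : MvPolynomial σ R →ₐ[R] Polynomial R :=
  aeval ((Polynomial.X : Polynomial R) • (Polynomial.C ∘ v))

theorem eval_restrictLine (v : σ → R) (f : MvPolynomial σ R) (t : R) :
    (restrictLine v f).eval t = eval (t • v) f := by
  have h : (Polynomial.aeval t).comp (restrictLine v) = aeval (t • v) := by
    ext i
    simpa [restrictLine] using mul_comm _ _
  simpa [aeval_eq_eval] using DFunLike.congr_fun h f

theorem restrictLine_of_isHomogeneous {f : MvPolynomial σ R} {d : ℕ} (hf : f.IsHomogeneous d)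
    (v : σ → R) : restrictLine v f = Polynomial.C (eval v f) * Polynomial.X ^ d := by
  rw [restrictLine, aeval_smul_of_isHomogeneous hf, mul_comm]
  exact congrArg (· * _) (aeval_algebraMap_apply (Polynomial R) v f)

theorem coeff_restrictLine (v : σ → R) (f : MvPolynomial σ R) (d : ℕ) :
    (restrictLine v f).coeff d = eval v (homogeneousComponent d f) := by
  have hcomponent (e : ℕ) : (restrictLine v (homogeneousComponent e f)).coeff d =
      if d = e then eval v (homogeneousComponent e f) else 0 := by
    rw [restrictLine_of_isHomogeneous (homogeneousComponent_isHomogeneous e f),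
      Polynomial.coeff_C_mul_X_pow]
  conv_lhs => rw [← sum_homogeneousComponent f, map_sum, Polynomial.finsetSum_coeff]
  simp only [hcomponent, Finset.sum_ite_eq, Finset.mem_range, ite_eq_left_iff, not_lt]
  exact fun hd => by rw [homogeneousComponent_eq_zero _ _ hd, map_zero]

end RestrictLine

section ProjectiveVanishing

open MvPolynomial

variable {n : ℕ}

theorem vanishesAt_mk_iff (f : MvPolynomial (Fin (n + 1)) ℂ) {v : Fin (n + 1) → ℂ} (hv : v ≠ 0) :
    VanishesAt f (Projectivization.mk ℂ v hv) ↔ restrictLine v f = 0 := by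
  constructor
  · intro h
    have h0 : restrictLine v f * Polynomial.X = 0 := Polynomial.funext fun t => by
      rcases eq_or_ne t 0 with rfl | ht
      · simp
      · have htv : t • v ≠ 0 := smul_ne_zero ht hv
        have := h (t • v) htv ((Projectivization.mk_eq_mk_iff' ℂ _ _ htv hv).2 ⟨t, rfl⟩)
        simp [eval_restrictLine, this]
    exact (mul_eq_zero.1 h0).resolve_right Polynomial.X_ne_zero
  · intro h w hw hwv
    obtain ⟨a, rfl⟩ := (Projectivization.mk_eq_mk_iff' ℂ _ _ hw hv).1 hwv
    rw [← eval_restrictLine, h, Polynomial.eval_zero]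

theorem vanishesAt_mk_iff_of_isHomogeneous {f : MvPolynomial (Fin (n + 1)) ℂ} {d : ℕ}
    (hf : f.IsHomogeneous d) {v : Fin (n + 1) → ℂ} (hv : v ≠ 0) :
    VanishesAt f (Projectivization.mk ℂ v hv) ↔ eval v f = 0 := by
  simp [vanishesAt_mk_iff, restrictLine_of_isHomogeneous hf]

theorem vanishesAt_mul_iff (f g : MvPolynomial (Fin (n + 1)) ℂ) (p : ProjSpace n) :
    VanishesAt (f * g) p ↔ VanishesAt f p ∨ VanishesAt g p := by
  induction p using Projectivization.ind with
  | h v hv => simp only [vanishesAt_mk_iff, map_mul, mul_eq_zero]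

theorem not_vanishesAt_one (p : ProjSpace n) :
    ¬ VanishesAt (1 : MvPolynomial (Fin (n + 1)) ℂ) p := by
  induction p using Projectivization.ind with
  | h v hv => simp [vanishesAt_mk_iff]

theorem vanishesAt_iff_homogeneousComponent (f : MvPolynomial (Fin (n + 1)) ℂ) (p : ProjSpace n) :
    VanishesAt f p ↔ ∀ d, VanishesAt (homogeneousComponent d f) p := by
  induction p using Projectivization.ind with
  | h v hv =>
    simp only [vanishesAt_mk_iff, Polynomial.ext_iff, coeff_restrictLine, Polynomial.coeff_zero,
      vanishesAt_mk_iff_of_isHomogeneous (homogeneousComponent_isHomogeneous _ f)]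

theorem isClosed_hypersurface (f : MvPolynomial (Fin (n + 1)) ℂ) : IsClosed (hypersurface f) := by
  have h : hypersurface f = ⋂ d, hypersurface (homogeneousComponent d f) := by
    ext p
    rw [Set.mem_iInter]
    exact vanishesAt_iff_homogeneousComponent f p
  rw [h]
  exact isClosed_iInter fun d => ⟨TopologicalSpace.isOpen_generateFrom_of_mem
    ⟨d, _, homogeneousComponent_isHomogeneous d f, rfl⟩⟩

theorem exists_form_of_mem_isOpen {U : Set (ProjSpace n)} (hU : IsOpen U) {p : ProjSpace n}
    (hp : p ∈ U) : ∃ (d : ℕ) (f : MvPolynomial (Fin (n + 1)) ℂ), f.IsHomogeneous d ∧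
      f ∈ vanishingIdeal Uᶜ ∧ ¬ VanishesAt f p := by
  change TopologicalSpace.GenerateOpen _ U at hU
  induction hU with
  | basic U h =>
    obtain ⟨d, f, hf, rfl⟩ := h
    exact ⟨d, f, hf, fun x hx => not_not.1 hx, hp⟩
  | univ =>
    exact ⟨0, 1, isHomogeneous_one _ _, fun x hx => (hx trivial).elim, not_vanishesAt_one p⟩
  | inter U₁ U₂ _ _ ih₁ ih₂ =>
    obtain ⟨d₁, f₁, hf₁, hU₁, hp₁⟩ := ih₁ hp.1
    obtain ⟨d₂, f₂, hf₂, hU₂, hp₂⟩ := ih₂ hp.2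
    refine ⟨d₁ + d₂, f₁ * f₂, hf₁.mul hf₂, fun x hx => (vanishesAt_mul_iff _ _ _).2 ?_,
      fun h => ((vanishesAt_mul_iff _ _ _).1 h).elim hp₁ hp₂⟩
    rw [Set.compl_inter] at hx
    exact hx.imp (hU₁ x) (hU₂ x)
  | sUnion 𝒰 _ ih =>
    obtain ⟨U, hU, hpU⟩ := hp
    obtain ⟨d, f, hf, hfU, hfp⟩ := ih U hU hpU
    exact ⟨d, f, hf, fun x hx => hfU x fun hxU => hx ⟨U, hU, hxU⟩, hfp⟩

theorem exists_form_of_notMem {W : Set (ProjSpace n)} (hW : IsClosed W) {p : ProjSpace n}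
    (hp : p ∉ W) : ∃ (d : ℕ) (f : MvPolynomial (Fin (n + 1)) ℂ), f.IsHomogeneous d ∧
      f ∈ vanishingIdeal W ∧ ¬ VanishesAt f p := by
  simpa only [compl_compl] using exists_form_of_mem_isOpen hW.isOpen_compl hp

theorem vanishingIdeal_isPrime {W : Set (ProjSpace n)} (hW : IsIrreducible W) :
    (vanishingIdeal W).IsPrime := by
  refine ⟨?_, fun {f g} hfg => ?_⟩
  · obtain ⟨p, hp⟩ := hW.nonempty
    rw [Ideal.ne_top_iff_one]
    exact fun h => not_vanishesAt_one p (h p hp)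
  · exact isPreirreducible_iff_isClosed_union_isClosed.1 hW.isPreirreducible
      (hypersurface f) (hypersurface g) (isClosed_hypersurface f) (isClosed_hypersurface g)
      fun p hp => (vanishesAt_mul_iff f g p).1 (hfg p hp)

theorem vanishingIdeal_lt_of_ssubset {W W' : Set (ProjSpace n)} (hW : IsClosed W) (h : W ⊂ W') :
    vanishingIdeal W' < vanishingIdeal W := by
  obtain ⟨p, hpW', hpW⟩ := Set.exists_of_ssubset h
  obtain ⟨d, f, -, hfW, hfp⟩ := exists_form_of_notMem hW hpW
  exact SetLike.lt_iff_le_and_exists.2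
    ⟨fun g hg x hx => hg x (h.subset hx), f, hfW, fun hfW' => hfp (hfW' p hpW')⟩

theorem mem_zeroLocus_vanishingIdeal_iff {W : Set (ProjSpace n)} (hW : IsClosed W)
    {v : Fin (n + 1) → ℂ} (hv : v ≠ 0) :
    v ∈ zeroLocus ℂ (vanishingIdeal W) ↔ Projectivization.mk ℂ v hv ∈ W := by
  refine ⟨fun h => ?_, fun h f hf => ?_⟩
  · by_contra hnot
    obtain ⟨d, f, hf, hfW, hfv⟩ := exists_form_of_notMem hW hnot
    rw [vanishesAt_mk_iff_of_isHomogeneous hf] at hfv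
    exact hfv (by simpa only [aeval_eq_eval] using h f hfW)
  · simpa only [aeval_eq_eval] using hf _ h v hv rfl

/-- The irrelevant ideal `(x₀, …, xₙ)`, encoded as the ideal of the origin of the affine cone, which
makes it a prime to which the Nullstellensatz applies directly. -/
noncomputable def irrelevantPrime (n : ℕ) : PrimeSpectrum (MvPolynomial (Fin (n + 1)) ℂ) :=
  ⟨MvPolynomial.vanishingIdeal ℂ {(0 : Fin (n + 1) → ℂ)}, inferInstance⟩

theorem mem_irrelevantPrime_iff {f : MvPolynomial (Fin (n + 1)) ℂ} :
    f ∈ (irrelevantPrime n).asIdeal ↔ eval 0 f = 0 :=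
  mem_vanishingIdeal_singleton_iff 0 f

theorem mem_irrelevantPrime_of_isHomogeneous {f : MvPolynomial (Fin (n + 1)) ℂ} {d : ℕ}
    (hf : f.IsHomogeneous d) (hd : d ≠ 0) : f ∈ (irrelevantPrime n).asIdeal := by
  have h := aeval_smul_of_isHomogeneous hf (0 : ℂ) 0
  rw [smul_zero, zero_pow hd, zero_mul] at h
  exact mem_irrelevantPrime_iff.2 h

theorem vanishingIdeal_lt_irrelevantPrime {W : Set (ProjSpace n)} (hW : W.Nonempty) :
    vanishingIdeal W < (irrelevantPrime n).asIdeal := by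
  obtain ⟨p, hp⟩ := hW
  induction p using Projectivization.ind with
  | h v hv =>
    obtain ⟨i, hi⟩ := Function.ne_iff.1 hv
    refine SetLike.lt_iff_le_and_exists.2 ⟨fun f hf => mem_irrelevantPrime_iff.2 ?_, X i,
      mem_irrelevantPrime_of_isHomogeneous (isHomogeneous_X ℂ i) one_ne_zero, fun hX => hi ?_⟩
    · rw [← zero_smul ℂ v, ← eval_restrictLine, (vanishesAt_mk_iff f hv).1 (hf _ hp),
        Polynomial.eval_zero]
    · simpa only [eval_X] using! hX _ hp v hv rfl

theorem irrelevantPrime_mem_minimalPrimes {W : Set (ProjSpace n)} (hW : IsClosed W)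
    (hne : W.Nonempty) {T : Set (MvPolynomial (Fin (n + 1)) ℂ)}
    (hT : ∀ f ∈ T, ∃ d ≠ 0, f.IsHomogeneous d) (hno : ∀ p ∈ W, ∃ f ∈ T, ¬ VanishesAt f p) :
    (irrelevantPrime n).asIdeal ∈ (vanishingIdeal W ⊔ Ideal.span T).minimalPrimes := by
  have hzero : zeroLocus ℂ (vanishingIdeal W ⊔ Ideal.span T) ⊆ {(0 : Fin (n + 1) → ℂ)} := by
    refine fun v hv => by_contra fun hv0 : v ≠ 0 => ?_
    obtain ⟨f, hfT, hf⟩ := hno _ <| (mem_zeroLocus_vanishingIdeal_iff hW hv0).1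
      fun g hg => hv g (Ideal.mem_sup_left hg)
    obtain ⟨d, -, hfd⟩ := hT f hfT
    rw [vanishesAt_mk_iff_of_isHomogeneous hfd, ← aeval_eq_eval] at hf
    exact hf (hv f (Ideal.mem_sup_right (Ideal.subset_span hfT)))
  refine ⟨⟨(irrelevantPrime n).isPrime, sup_le (vanishingIdeal_lt_irrelevantPrime hne).le
    (Ideal.span_le.2 fun f hf => ?_)⟩, fun I hI _ => ?_⟩
  · obtain ⟨d, hd, hfd⟩ := hT f hf
    exact mem_irrelevantPrime_of_isHomogeneous hfd hd
  · calc (irrelevantPrime n).asIdeal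
        ≤ (vanishingIdeal W ⊔ Ideal.span T).radical := by
          rw [← vanishingIdeal_zeroLocus_eq_radical (K := ℂ)]
          exact vanishingIdeal_anti_mono hzero
      _ ≤ I := hI.1.radical_le_iff.2 hI.2

end ProjectiveVanishing

section Dimension

theorem length_le_card_of_mem_minimalPrimes {R : Type*} [CommRing R] [IsNoetherianRing R]
    (s : LTSeries (PrimeSpectrum R)) (T : Finset R)
    (hT : s.last.asIdeal ∈ (s.head.asIdeal ⊔ Ideal.span T).minimalPrimes) :
    s.length ≤ T.card := by
  classical
  set P := s.head.asIdeal
  let e := P.primeSpectrumQuotientOrderIsoZeroLocus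
  let s' : LTSeries (PrimeSpectrum (R ⧸ P)) := LTSeries.mk s.length
    (fun i => e.symm ⟨s i, s.head_le i⟩) (fun i j hij => e.symm.strictMono (s.strictMono hij))
  have hmin : s'.last.asIdeal ∈
      (Ideal.span (T.image (Ideal.Quotient.mk P) : Set (R ⧸ P))).minimalPrimes := by
    rw [Finset.coe_image, ← Ideal.map_span,
      Ideal.minimalPrimes_map_of_surjective Ideal.Quotient.mk_surjective, Ideal.mk_ker, sup_comm]
    exact ⟨s.last.asIdeal, hT, rfl⟩
  have hheight := Ideal.height_le_card_of_mem_minimalPrimes_span_finset hmin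
  rw [PrimeSpectrum.height_eq_orderHeight] at hheight
  have hlength : s.length ≤ (T.image (Ideal.Quotient.mk P)).card := by
    exact_mod_cast (Order.length_le_height_last (p := s')).trans hheight
  exact hlength.trans Finset.card_image_le

open TopologicalSpace (IrreducibleCloseds)

variable {n : ℕ}

/-- The homogeneous prime ideal of an irreducible closed subset of projective space. -/
def vanishingPrime (Y : IrreducibleCloseds (ProjSpace n)) :
    PrimeSpectrum (MvPolynomial (Fin (n + 1)) ℂ) :=
  ⟨vanishingIdeal Y, vanishingIdeal_isPrime Y.isIrreducible⟩

theorem vanishingPrime_strictAnti : StrictAnti (vanishingPrime (n := n)) :=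
  fun Y _ h => vanishingIdeal_lt_of_ssubset Y.isClosed h

/- The primes of the members of the chain, followed by the irrelevant ideal, form a chain of length
`l.length + 1` to which Krull's height theorem applies. -/
theorem length_lt_card_of_forall_exists_not_vanishesAt
    (l : LTSeries (IrreducibleCloseds (ProjSpace n)))
    {T : Finset (MvPolynomial (Fin (n + 1)) ℂ)} (hT : ∀ f ∈ T, ∃ d ≠ 0, f.IsHomogeneous d)
    (hno : ∀ p ∈ l.last, ∃ f ∈ T, ¬ VanishesAt f p) : l.length < T.card := by
  let c : LTSeries (PrimeSpectrum (MvPolynomial (Fin (n + 1)) ℂ)) :=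
    LTSeries.mk l.length (fun i => vanishingPrime (l i.rev))
      (fun i j hij => vanishingPrime_strictAnti (l.strictMono (Fin.rev_lt_rev.2 hij)))
  have hlast : c.last < irrelevantPrime n :=
    vanishingIdeal_lt_irrelevantPrime (l _).isIrreducible.nonempty
  have hhead : (c.snoc (irrelevantPrime n) hlast).head = vanishingPrime l.last := by
    rw [RelSeries.head_snoc]
    exact congrArg (fun i => vanishingPrime (l i)) (Fin.rev_zero _)
  refine length_le_card_of_mem_minimalPrimes (c.snoc (irrelevantPrime n) hlast) T ?_
  rw [hhead, RelSeries.last_snoc]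
  exact irrelevantPrime_mem_minimalPrimes l.last.isClosed l.last.isIrreducible.nonempty hT hno

theorem exists_mem_forall_vanishesAt_of_card_le {k : ℕ} {V : Set (ProjSpace n)} (hV : IsClosed V)
    (hdim : (k : WithBot ℕ∞) ≤ topologicalKrullDim V) {T : Finset (MvPolynomial (Fin (n + 1)) ℂ)}
    (hT : ∀ f ∈ T, ∃ d ≠ 0, f.IsHomogeneous d) (hTk : T.card ≤ k) :
    ∃ p ∈ V, ∀ f ∈ T, VanishesAt f p := by
  by_contra! hno
  obtain ⟨l, rfl⟩ := Order.le_krullDim_iff.1 hdim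
  let l' := l.map _ <| IrreducibleCloseds.map_strictMono_of_isInducing
    (Topology.IsInducing.subtypeVal (t := V))
  have hl' : (l'.last : Set (ProjSpace n)) ⊆ V :=
    closure_minimal (by rintro _ ⟨x, -, rfl⟩; exact x.2) hV
  exact (length_lt_card_of_forall_exists_not_vanishesAt l' hT fun p hp => hno p (hl' hp)).not_ge hTk

end Dimension

section Rank

open Submodule

theorem isRankFunction_finrank_span {K M ι : Type*} [DivisionRing K] [AddCommGroup M] [Module K M]
    [DecidableEq ι] (v : ι → M) :
    IsRankFunction fun R : Finset ι => Module.finrank K (span K (v '' R)) := by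
  have hfin (R : Finset ι) : FiniteDimensional K (span K (v '' R)) :=
    FiniteDimensional.span_of_finite K (R.finite_toSet.image v)
  have hmono {S T : Finset ι} (h : S ⊆ T) : span K (v '' S) ≤ span K (v '' T) :=
    span_mono (Set.image_mono (Finset.coe_subset.2 h))
  refine ⟨by simp, fun _ _ h => finrank_mono (hmono h), fun i S => ?_, fun S T => ?_⟩
  · rw [Finset.coe_insert, Set.image_insert_eq, Set.insert_eq, span_union, add_comm]
    refine (finrank_add_le_finrank_add_finrank _ _).trans ?_
    gcongr
    simpa using finrank_span_le_card (R := K) ({v i} : Set M)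
  · rw [← finrank_sup_add_finrank_inf_eq (span K (v '' S)) (span K (v '' T)), Finset.coe_union,
      Set.image_union, span_union]
    gcongr
    exact finrank_mono (le_inf (hmono Finset.inter_subset_left) (hmono Finset.inter_subset_right))

theorem IsRankBasis.span_image_eq {K M ι : Type*} [DivisionRing K] [AddCommGroup M] [Module K M]
    {v : ι → M} {B R : Finset ι}
    (hB : IsRankBasis (fun R : Finset ι => Module.finrank K (span K (v '' R))) B R) :
    span K (v '' B) = span K (v '' R) :=
  have := FiniteDimensional.span_of_finite K (R.finite_toSet.image v)
  eq_of_le_of_finrank_eq (span_mono (Set.image_mono (Finset.coe_subset.2 hB.subset))) hB.rank_eq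

variable {n d q : ℕ} {V : Set (ProjSpace n)} {Q : Fin q → Forms n d}

theorem isRankFunction_rankOn : IsRankFunction (rankOn V Q) :=
  isRankFunction_finrank_span fun i => (Submodule.Quotient.mk (Q i) : FormsOn V d)

theorem vanishesAt_of_mkQ_mem_span {S : Set (Forms n d)} {p : ProjSpace n} (hp : p ∈ V)
    (hS : ∀ G ∈ S, VanishesAt (G : MvPolynomial (Fin (n + 1)) ℂ) p) {F : Forms n d}
    (hF : (vanishingForms V d).mkQ F ∈ span ℂ ((vanishingForms V d).mkQ '' S)) :
    VanishesAt (F : MvPolynomial (Fin (n + 1)) ℂ) p := by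
  have hle : vanishingForms V d ⊔ span ℂ S ≤ vanishingForms {p} d :=
    sup_le (fun G hG x hx => hx ▸ hG p hp) (span_le.2 fun G hG x hx => hx ▸ hS G hG)
  rw [← map_span, ← mem_comap, comap_map_mkQ] at hF
  exact hle hF p rfl

theorem lt_rankOn_of_inter_eq_empty {k : ℕ} (hd : d ≠ 0) (hV : IsClosed V)
    (hdim : (k : WithBot ℕ∞) ≤ topologicalKrullDim V) {R : Finset (Fin q)}
    (hR : V ∩ ⋂ i ∈ R, hypersurface (Q i : MvPolynomial (Fin (n + 1)) ℂ) = ∅) :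
    k < rankOn V Q R := by
  classical
  by_contra! hle
  obtain ⟨B, hB⟩ := (isRankFunction_rankOn (V := V) (Q := Q)).exists_isRankBasis R
  let T := B.image fun i => (Q i : MvPolynomial (Fin (n + 1)) ℂ)
  have hT : ∀ f ∈ T, ∃ e ≠ 0, f.IsHomogeneous e := Finset.forall_mem_image.2 fun i _ =>
    ⟨d, hd, (MvPolynomial.mem_homogeneousSubmodule _ _).1 (Q i).2⟩
  have hTk : T.card ≤ k := Finset.card_image_le.trans
    (hB.rank_self.symm.trans_le (hB.rank_eq.trans_le hle))
  obtain ⟨p, hp, hpT⟩ := exists_mem_forall_vanishesAt_of_card_le hV hdim hT hTk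
  refine hR.subset ⟨hp, Set.mem_iInter₂.2 fun i hi => ?_⟩
  refine vanishesAt_of_mkQ_mem_span (S := Q '' B) hp
    (Set.forall_mem_image.2 fun j hj => hpT _ (Finset.mem_image_of_mem _ hj)) ?_
  rw [← Set.image_comp]
  exact hB.span_image_eq.ge (subset_span ⟨i, hi, rfl⟩)

theorem rankOn_singleton_pos {i : Fin q}
    (hi : ¬ V ⊆ hypersurface (Q i : MvPolynomial (Fin (n + 1)) ℂ)) : 0 < rankOn V Q {i} := by
  have hne : (Submodule.Quotient.mk (Q i) : FormsOn V d) ≠ 0 := fun h =>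
    hi fun p hp => (Submodule.Quotient.mk_eq_zero _).1 h p hp
  rw [rankOn, Finset.coe_singleton, Set.image_singleton, finrank_span_singleton hne]
  exact one_pos

end Rank

end NochkaWeights

theorem mainTheorem4_general (n k N d q : ℕ) (hk : 1 ≤ k) (hd : 1 ≤ d)
    (V : Set (NochkaWeights.ProjSpace n)) (hV : IsClosed V)
    (hdim : (k : WithBot ℕ∞) ≤ topologicalKrullDim V)
    (Q : Fin q → NochkaWeights.Forms n d)
    (hQV : ∀ i, ¬ V ⊆ NochkaWeights.hypersurface (Q i : MvPolynomial (Fin (n + 1)) ℂ))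
    (hpos : NochkaWeights.InSubgeneralPosition N V Q)
    (hqk : k + 1 ≤ q) (hq : 2 * (N : ℤ) - k + 1 < q) :
    ∃ (ω : Fin q → ℚ) (ωt : ℚ),
      (∀ i, 0 < ω i ∧ ω i ≤ 1) ∧
      IsGreatest (Set.range ω) ωt ∧
      ∑ i, ω i = ωt * ((q : ℚ) - 2 * N + k - 1) + k + 1 ∧
      ((k : ℚ) + 1) / (2 * N - k + 1) ≤ ωt ∧
      ωt ≤ (k : ℚ) / N ∧
      (∀ R : Finset (Fin q), R.card = N + 1 → ∑ i ∈ R, ω i ≤ (k : ℚ) + 1) ∧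
      (∀ E : Fin q → ℝ, (∀ i, 1 ≤ E i) →
        ∀ R : Finset (Fin q), R.card = N + 1 →
          ∃ R' ⊆ R, R'.card = k + 1 ∧ NochkaWeights.rankOn V Q R' = k + 1 ∧
            ∏ i ∈ R, E i ^ (ω i : ℝ) ≤ ∏ i ∈ R', E i) := by
  have hloop : ∀ i, 0 < NochkaWeights.rankOn V Q {i} := fun i =>
    NochkaWeights.rankOn_singleton_pos (hQV i)
  have hspanning : ∀ R : Finset (Fin q), R.card = N + 1 → k < NochkaWeights.rankOn V Q R :=
    fun R hR => NochkaWeights.lt_rankOn_of_inter_eq_empty (Nat.one_le_iff_ne_zero.1 hd) hV hdim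
      (hpos R hR)
  have hq' : 2 * N + 1 < Fintype.card (Fin q) + k := by rw [Fintype.card_fin]; omega
  simpa only [Fintype.card_fin] using NochkaWeights.isRankFunction_rankOn.exists_nochka_weights
    hloop hk (hqk.trans_eq (Fintype.card_fin q).symm) hq' hspanning

theorem mainTheorem4 (n k N d q : ℕ) (hk : 1 ≤ k) (hd : 1 ≤ d)
    (V : Set (NochkaWeights.ProjSpace n)) (hV : IsClosed V)
    (hdim : topologicalKrullDim V = (k : WithBot ℕ∞))
    (Q : Fin q → NochkaWeights.Forms n d)
    (hQV : ∀ i, ¬ V ⊆ NochkaWeights.hypersurface (Q i : MvPolynomial (Fin (n + 1)) ℂ))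
    (hpos : NochkaWeights.InSubgeneralPosition N V Q)
    (hqk : k + 1 ≤ q) (hq : 2 * (N : ℤ) - k + 1 < q) :
    ∃ (ω : Fin q → ℚ) (ωt : ℚ),
      (∀ i, 0 < ω i ∧ ω i ≤ 1) ∧
      IsGreatest (Set.range ω) ωt ∧
      ∑ i, ω i = ωt * ((q : ℚ) - 2 * N + k - 1) + k + 1 ∧
      ((k : ℚ) + 1) / (2 * N - k + 1) ≤ ωt ∧
      ωt ≤ (k : ℚ) / N ∧
      (∀ R : Finset (Fin q), R.card = N + 1 → ∑ i ∈ R, ω i ≤ (k : ℚ) + 1) ∧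
      (∀ E : Fin q → ℝ, (∀ i, 1 ≤ E i) →
        ∀ R : Finset (Fin q), R.card = N + 1 →
          ∃ R' ⊆ R, R'.card = k + 1 ∧ NochkaWeights.rankOn V Q R' = k + 1 ∧
            ∏ i ∈ R, E i ^ (ω i : ℝ) ≤ ∏ i ∈ R', E i) :=
  mainTheorem4_general n k N d q hk hd V hV hdim.ge Q hQV hpos hqk hq
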